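/- Let $G=(V,E)$ be a finite strongly connected digraph and let $s\in V$ be an arbitrary start vertex. Let $G_s$ denote $G$ viewed as a flow graph with start vertex $s$, and let $G_s^R$ denote the reverse digraph of $G$ viewed as a flow graph with start vertex $s$. For $G_s$, a vertex $u$ \emph{dominates} $v$ if every path from $s$ to $v$ contains $u$. The \emph{dominator tree} $D$ is the tree rooted at $s$ in which $u$ is an ancestor of $v$ if and only if $u$ dominates $v$. An edge $(u,v)\in E$ is a \emph{bridge} of $G_s$ if every path from $s$ to $v$ contains $(u,v)$; then $u$ is the parent of $v$ in $D$. Deleting all bridges from $D$ yields a forest, the \emph{bridge decomposition}; let $r_x$ denote the root of the tree of this forest that contains $x$. For each such root $r$ let $V_r=\{v\in V: r_v=r\}$. The \emph{auxiliary graph} $\widehat G_r$ has vertex set $V_r$ and is obtained from the subgraph of $G$ induced by the descendants of $r$ in $D$ by contracting, for every $v\in V_r$ and every child $w\notin V_r$ of $v$ in $D$, the vertex $w$ and all its descendants in $D$ into $v$. The \emph{auxiliary components} of $G_s$ are the (vertex sets of the) strongly connected components of the graphs $\widehat G_r$. In each auxiliary component choose an arbitrary \emph{canonical vertex}, and let $c_x$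 be the canonical vertex of the auxiliary component that contains $x$. Define $r^R_x$ and $c^R_x$ in the same way for $G_s^R$ (with its own arbitrary choice of canonical vertices), and let $$\mathit{label}(x)=\langle r_x,\,c_x,\,r^R_x,\,c^R_x\rangle .$$ Two vertices $x,y$ are \emph{2-edge-connected} if there are two edge-disjoint directed paths from $x$ to $y$ and two edge-disjoint directed paths from $y$ to $x$ (every vertex is 2-edge-connected to itself, by trivial paths). Then, for all $x,y\in V$, the vertices $x$ and $y$ are 2-edge-connected if and only if $\mathit{label}(x)=\mathit{label}(y)$. -/

import Mathlib

namespace Digraph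

variable {V : Type*}

/-- Directed walks (paths in which vertices and edges may repeat) of a digraph. -/
inductive Walk (G : Digraph V) : V → V → Type _
  | nil (u : V) : Walk G u u
  | cons {u v w : V} (h : G.Adj u v) (p : Walk G v w) : Walk G u w

namespace Walk

variable {G : Digraph V}

/-- The list of vertices of a walk, endpoints included. -/
def support : {u v : V} → G.Walk u v → List V
  | _, _, nil u => [u]
  | u, _, cons _ p => u :: p.support

/-- The list of edges of a walk, as ordered pairs (tail, head). -/
def edges : {u v : V} → G.Walk u v → List (V × V)
  | _, _, nil _ => []
  | _, _, @cons _ _ u v _ _ p => (u, v) :: p.edges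

end Walk

/-- `v` is reachable from `u`. -/
def Reaches (G : Digraph V) (u v : V) : Prop := Nonempty (G.Walk u v)

/-- There is a directed path from each vertex to every other vertex. -/
def StronglyConnected (G : Digraph V) : Prop := ∀ u v, G.Reaches u v

/-- The vertex set of the strongly connected component containing `x`. -/
def scc (G : Digraph V) (x : V) : Set V := {y | G.Reaches x y ∧ G.Reaches y x}

/-- The reverse digraph. -/
def reverse (G : Digraph V) : Digraph V where
  Adj u v := G.Adj v u

/-- There are two edge-disjoint directed paths from `u` to `v`. -/
def TwoEdgeDisjointPaths (G : Digraph V) (u v : V) : Prop :=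
  ∃ p q : G.Walk u v, p.edges.Disjoint q.edges

/-- Two vertices are 2-edge-connected: two edge-disjoint directed paths in each direction. -/
def TwoEdgeConnected (G : Digraph V) (u v : V) : Prop :=
  G.TwoEdgeDisjointPaths u v ∧ G.TwoEdgeDisjointPaths v u

/-- `u` dominates `v` in the flow graph `G` with start vertex `s`. By definition of the dominator
tree `D`, this says that `u` is an ancestor of `v` (and `v` a descendant of `u`) in `D`. -/
def Dominates (G : Digraph V) (s u v : V) : Prop := ∀ p : G.Walk s v, u ∈ p.support

/-- The dominator tree `D` of the flow graph `G` with start vertex `s`, with its edges directed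
away from the root: the parent `d(v)` of `v` is the proper dominator of `v` that is dominated by
all proper dominators of `v`. -/
def domTree (G : Digraph V) (s : V) : Digraph V where
  Adj u v := u ≠ v ∧ G.Dominates s u v ∧ ∀ w, w ≠ v → G.Dominates s w v → G.Dominates s w u

/-- The edge `(u, v)` is a bridge of the flow graph `G` with start vertex `s`. -/
def IsBridge (G : Digraph V) (s u v : V) : Prop :=
  G.Adj u v ∧ ∀ p : G.Walk s v, (u, v) ∈ p.edges

/-- The bridge decomposition: the forest obtained from the dominator tree by deleting the
bridges of the flow graph. -/
def bridgeForest (G : Digraph V) (s : V) : Digraph V where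
  Adj u v := (G.domTree s).Adj u v ∧ ¬ G.IsBridge s u v

/-- `r` is the root of the tree of the bridge decomposition that contains `u`: it is an ancestor
of `u` in the forest and has no parent in the forest. -/
def IsBridgeRoot (G : Digraph V) (s r u : V) : Prop :=
  (G.bridgeForest s).Reaches r u ∧ ∀ w, ¬ (G.bridgeForest s).Adj w r

open Classical in
/-- The root `r_u` of the tree of the bridge decomposition containing `u`. (It exists and is
unique in every finite flow graph, see `existsUnique_isBridgeRoot` below.) -/
noncomputable def bridgeRoot (G : Digraph V) (s u : V) : V :=
  if h : ∃ r, G.IsBridgeRoot s r u then h.choose else u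

/-- The vertex set `V_r` of the auxiliary graph of `r`: the vertices of the tree with root `r`
of the bridge decomposition. -/
def auxVertices (G : Digraph V) (s r : V) : Set V := {v | G.bridgeRoot s v = r}

/-- The vertex `v` of `G` becomes the vertex `a` of `V_r` in the contraction that defines the
auxiliary graph of `r`: either `v = a`, or `v` is a descendant in `D` of a child `w` of `a` in `D`
that lies outside `V_r`. (Vertices that are not descendants of `r` become no vertex of `V_r`.) -/
def ContractsTo (G : Digraph V) (s r v a : V) : Prop :=
  a ∈ G.auxVertices s r ∧
    (v = a ∨ ∃ w, (G.domTree s).Adj a w ∧ w ∉ G.auxVertices s r ∧ G.Dominates s w v)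

/-- The auxiliary graph of `r`: its vertices are those of the tree with root `r` of the bridge
decomposition, its edges are the edges of `G` among them and the edges obtained
by the contraction. (A contracted edge may be a loop, which does not affect the SCCs.) -/
def auxGraph (G : Digraph V) (s r : V) : Digraph (G.auxVertices s r) where
  Adj a b := ∃ u v, G.Adj u v ∧ G.ContractsTo s r u a ∧ G.ContractsTo s r v b

/-- The auxiliary component containing `x`: the SCC of `x` in the auxiliary graph of `r_x`,
as a set of vertices of `G`. -/
def auxComponent (G : Digraph V) (s x : V) : Set V :=
  Subtype.val '' (G.auxGraph s (G.bridgeRoot s x)).scc ⟨x, rfl⟩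

/-- `can` picks a (canonical) vertex in each auxiliary component. Its values on other sets are
irrelevant. -/
def IsCanonicalChoice (G : Digraph V) (s : V) (can : Set V → V) : Prop :=
  ∀ x, can (G.auxComponent s x) ∈ G.auxComponent s x

/-- The label `⟨r_x, c_x, r^R_x, c^R_x⟩` of `x`, for the start vertex `s` and the choices `can`,
`canR` of canonical vertices of the auxiliary components of `G_s` and of `G_s^R`. -/
noncomputable def label (G : Digraph V) (s : V) (can canR : Set V → V) (x : V) : V × V × V × V :=
  (G.bridgeRoot s x, can (G.auxComponent s x),
    G.reverse.bridgeRoot s x, canR (G.reverse.auxComponent s x))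

/-! The remaining facts show that the roots of the bridge decomposition are well defined. -/

theorem Walk.exists_prefix {G : Digraph V} {u v w : V} (p : G.Walk u v) (h : w ∈ p.support) :
    ∃ q : G.Walk u w, q.support.length ≤ p.support.length ∧ (∀ x ∈ q.support, x ∈ p.support) ∧
      (w ≠ v → q.support.length < p.support.length) := by
  induction p with
  | nil u =>
    simp only [Walk.support, List.mem_singleton] at h
    subst h
    exact ⟨.nil _, le_rfl, fun x hx => hx, fun h => absurd rfl h⟩
  | @cons a b c hab p ih =>
    by_cases hw : w = a
    · subst hw
      refine ⟨.nil _, by simp [Walk.support], by simp [Walk.support], fun _ => ?_⟩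
      cases p <;> simp [Walk.support]
    · obtain ⟨q, h1, h2, h3⟩ := ih (by simpa [Walk.support, hw] using h)
      refine ⟨.cons hab q, by simpa [Walk.support] using h1, ?_, by simpa [Walk.support] using h3⟩
      intro x hx
      simp only [Walk.support, List.mem_cons] at hx ⊢
      exact hx.imp_right (h2 x)

theorem Dominates.trans {G : Digraph V} {s a b c : V} (h1 : G.Dominates s a b)
    (h2 : G.Dominates s b c) : G.Dominates s a c := by
  intro p
  obtain ⟨q, -, hq, -⟩ := p.exists_prefix (h2 p)
  exact hq _ (h1 q)

theorem Dominates.antisymm {G : Digraph V} {s a b : V} (hs : G.Reaches s a)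
    (h1 : G.Dominates s a b) (h2 : G.Dominates s b a) : a = b := by
  by_contra hab
  have key : ∀ n : ℕ, ∀ p : G.Walk s a, p.support.length ≠ n := by
    intro n
    induction n using Nat.strong_induction_on with
    | _ n ih =>
      intro p hp
      obtain ⟨q, -, -, hq⟩ := p.exists_prefix (h2 p)
      obtain ⟨q', hq', -, -⟩ := q.exists_prefix (h1 q)
      exact ih _ (by have := hq (Ne.symm hab); omega) q' rfl
  obtain ⟨p⟩ := hs
  exact key _ p rfl

theorem Walk.exists_last {G : Digraph V} {u v : V} (p : G.Walk u v) :
    u = v ∨ ∃ w, G.Reaches u w ∧ G.Adj w v := by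
  induction p with
  | nil u => exact Or.inl rfl
  | @cons a b c hab p ih =>
    rcases ih with rfl | ⟨w, ⟨q⟩, hw⟩
    · exact Or.inr ⟨a, ⟨.nil a⟩, hab⟩
    · exact Or.inr ⟨w, ⟨.cons hab q⟩, hw⟩

theorem Reaches.concat {G : Digraph V} {u v w : V} (h : G.Reaches u v) (hvw : G.Adj v w) :
    G.Reaches u w := by
  obtain ⟨p⟩ := h
  induction p with
  | nil u => exact ⟨.cons hvw (.nil _)⟩
  | cons hab p ih =>
    obtain ⟨q⟩ := ih hvw
    exact ⟨.cons hab q⟩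

theorem existsUnique_isBridgeRoot [Finite V] (G : Digraph V) (s : V) (hs : ∀ v, G.Reaches s v)
    (u : V) : ∃! r, G.IsBridgeRoot s r u := by
  let R : V → V → Prop := fun a b => a ≠ b ∧ G.Dominates s a b
  have : IsTrans V R := ⟨fun a b c hab hbc => ⟨by
    rintro rfl
    exact hab.1 (hab.2.antisymm (hs _) hbc.2), hab.2.trans hbc.2⟩⟩
  have : Std.Irrefl R := ⟨fun a h => h.1 rfl⟩
  have wf : WellFounded R := Finite.wellFounded_of_trans_of_irrefl R
  have par : ∀ a b c, (G.bridgeForest s).Adj a c → (G.bridgeForest s).Adj b c → a = b := by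
    intro a b c h1 h2
    exact (h2.1.2.2 a h1.1.1 h1.1.2.1).antisymm (hs _) (h1.1.2.2 b h2.1.1 h2.1.2.1)
  induction u using wf.induction with
  | _ u ih =>
    by_cases h : ∃ w, (G.bridgeForest s).Adj w u
    · obtain ⟨w, hw⟩ := h
      obtain ⟨r, hr, hu⟩ := ih w ⟨hw.1.1, hw.1.2.1⟩
      refine ⟨r, ⟨hr.1.concat hw, hr.2⟩, ?_⟩
      rintro r' ⟨⟨p⟩, hr'⟩
      rcases p.exists_last with rfl | ⟨w', h1, h2⟩
      · exact absurd hw (hr' w)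
      · obtain rfl := par _ _ _ h2 hw
        exact hu r' ⟨h1, hr'⟩
    · push Not at h
      refine ⟨u, ⟨⟨.nil u⟩, h⟩, ?_⟩
      rintro r' ⟨⟨p⟩, hr'⟩
      rcases p.exists_last with rfl | ⟨w', h1, h2⟩
      · rfl
      · exact absurd h2 (h w')

end Digraph

/-!
For an edge `e`, write `G - e` for `G` without `e`. By Menger's theorem `x` and `y` are
2-edge-connected iff they reach each other in every `G - e`.

The vertex `r_x` records which bridges separate `x` from `s`, and the contraction defining the
auxiliary graph of `r` creates no new reachability inside `V_r`: each subtree of `D` that is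
contracted into a vertex `v` can be entered only through a bridge leaving `v`. Hence `x` and `y`
lie in the same auxiliary component of `G_s` iff for every edge `e`, in `G - e`, either `s` reaches
both of them or they reach each other. Dually, they lie in the same auxiliary component of `G_s^R`
iff for every `e`, in `G - e`, either both reach `s` or they reach each other. When the first
alternative occurs in both conditions for some `e`, the walks `x → s → y` and `y → s → x` show that
`x` and `y` still reach each other in `G - e`.
-/

namespace FlowGraph

open Digraph

variable {V : Type*} {G : Digraph V} {s u v w x y z a b c r : V} {e : V × V}

/-! ### Walks -/

/-- Concatenation of walks, used to splice reachability witnesses. -/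
def append : {u v w : V} → G.Walk u v → G.Walk v w → G.Walk u w
  | _, _, _, .nil _, q => q
  | _, _, _, .cons h p, q => .cons h (append p q)

theorem support_eq_cons_tail (p : G.Walk u v) : p.support = u :: p.support.tail := by
  cases p <;> rfl

theorem start_mem_support (p : G.Walk u v) : u ∈ p.support := by
  cases p <;> simp [Walk.support]

theorem end_mem_support (p : G.Walk u v) : v ∈ p.support := by
  induction p with
  | nil u => simp [Walk.support]
  | cons _ p ih => simp [Walk.support, ih]

theorem support_append (p : G.Walk u v) (q : G.Walk v w) :
    (append p q).support = p.support ++ q.support.tail := by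
  induction p with
  | nil u => exact support_eq_cons_tail q
  | cons h p ih => simp only [append, Walk.support, ih, List.cons_append]

theorem edges_append (p : G.Walk u v) (q : G.Walk v w) :
    (append p q).edges = p.edges ++ q.edges := by
  induction p with
  | nil u => rfl
  | cons h p ih => simp only [append, Walk.edges, ih, List.cons_append]

theorem adj_of_mem_edges (p : G.Walk u v) (he : e ∈ p.edges) : G.Adj e.1 e.2 := by
  induction p with
  | nil u => simp [Walk.edges] at he
  | cons h p ih =>
    rcases List.mem_cons.1 he with rfl | he
    · exact h
    · exact ih he

theorem fst_mem_support_of_mem_edges (p : G.Walk u v) (he : e ∈ p.edges) : e.1 ∈ p.support := by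
  induction p with
  | nil u => simp [Walk.edges] at he
  | cons h p ih =>
    rcases List.mem_cons.1 he with rfl | he
    · simp [Walk.support]
    · simp [Walk.support, ih he]

theorem snd_mem_support_tail_of_mem_edges (p : G.Walk u v) (he : e ∈ p.edges) :
    e.2 ∈ p.support.tail := by
  induction p with
  | nil u => simp [Walk.edges] at he
  | cons h p ih =>
    rcases List.mem_cons.1 he with rfl | he
    · exact start_mem_support p
    · exact List.mem_of_mem_tail (ih he)

theorem exists_eq_append_of_mem_support (p : G.Walk u v) (hw : w ∈ p.support) :
    ∃ (q : G.Walk u w) (q' : G.Walk w v), p = append q q' := by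
  induction p with
  | nil u =>
    obtain rfl := List.mem_singleton.1 hw
    exact ⟨.nil _, .nil _, rfl⟩
  | cons h p ih =>
    rcases List.mem_cons.1 hw with rfl | hw
    · exact ⟨.nil _, .cons h p, rfl⟩
    · obtain ⟨q, q', rfl⟩ := ih hw
      exact ⟨.cons h q, q', rfl⟩

theorem exists_walk_from_last_visit (p : G.Walk u v) {S : Set V} (hS : ∃ w ∈ p.support, w ∈ S) :
    ∃ w ∈ S, ∃ q : G.Walk w v, q.edges ⊆ p.edges ∧ ∀ z ∈ q.support.tail, z ∉ S := by
  induction p with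
  | nil u =>
    obtain ⟨w, hw, hwS⟩ := hS
    obtain rfl := List.mem_singleton.1 hw
    exact ⟨w, hwS, .nil w, List.Subset.refl _, by simp [Walk.support]⟩
  | @cons a b c hab p ih =>
    by_cases hp : ∃ w ∈ p.support, w ∈ S
    · obtain ⟨w, hwS, q, hqp, hq⟩ := ih hp
      exact ⟨w, hwS, q, List.subset_cons_of_subset _ hqp, hq⟩
    · push Not at hp
      obtain ⟨w, hw, hwS⟩ := hS
      obtain rfl := (List.mem_cons.1 hw).resolve_right fun h => hp w h hwS
      exact ⟨w, hwS, .cons hab p, List.Subset.refl _, hp⟩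

theorem exists_walk_to_first_visit (p : G.Walk u v) {S : Set V} (hv : v ∈ S) :
    ∃ w ∈ S, ∃ q : G.Walk u w, q.edges ⊆ p.edges ∧ ∀ e ∈ q.edges, e.1 ∉ S := by
  induction p with
  | nil u => exact ⟨u, hv, .nil u, by simp [Walk.edges]⟩
  | @cons a b c hab p ih =>
    by_cases ha : a ∈ S
    · exact ⟨a, ha, .nil a, by simp [Walk.edges]⟩
    · obtain ⟨w, hw, q, hqp, hq⟩ := ih hv
      exact ⟨w, hw, .cons hab q, List.cons_subset_cons _ hqp, List.forall_mem_cons.2 ⟨ha, hq⟩⟩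

theorem exists_walk_edges_nodup (p : G.Walk u v) : ∃ q : G.Walk u v, q.edges.Nodup := by
  induction p with
  | nil u => exact ⟨.nil u, List.nodup_nil⟩
  | @cons a b c hab _ ih =>
    obtain ⟨q, hq⟩ := ih
    by_cases ha : a ∈ q.support
    · obtain ⟨q₁, q₂, rfl⟩ := exists_eq_append_of_mem_support q ha
      rw [edges_append] at hq
      exact ⟨q₂, hq.of_append_right⟩
    · exact ⟨.cons hab q, List.nodup_cons.2 ⟨fun h => ha (fst_mem_support_of_mem_edges q h), hq⟩⟩

theorem exists_walk_reverse (p : G.Walk u v) :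
    ∃ q : G.reverse.Walk v u, ∀ e, e ∈ q.edges ↔ e.swap ∈ p.edges := by
  induction p with
  | nil u => exact ⟨.nil u, by simp [Walk.edges]⟩
  | @cons a b c hab p ih =>
    obtain ⟨q, hq⟩ := ih
    refine ⟨append q (.cons hab (.nil a)), fun e => ?_⟩
    simp only [edges_append, Walk.edges, List.mem_append, List.mem_cons, List.not_mem_nil,
      or_false, hq, Prod.swap_eq_iff_eq_swap, Prod.swap_prod_mk]
    exact or_comm

theorem stronglyConnected_reverse (hG : G.StronglyConnected) : G.reverse.StronglyConnected :=
  fun u v => let ⟨p⟩ := hG v u; let ⟨q, _⟩ := exists_walk_reverse p; ⟨q⟩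

/-! ### Deleting an edge -/

/-- `v` is reachable from `u` in the digraph obtained from `G` by deleting the edge `e`.
Dominance, bridges, auxiliary components and 2-edge-connectivity are all expressed through it. The
pair `e` need not be an edge of `G`, in which case nothing is deleted. -/
def ReachesAvoiding (G : Digraph V) (e : V × V) (u v : V) : Prop :=
  ∃ p : G.Walk u v, e ∉ p.edges

namespace ReachesAvoiding

theorem trans (huv : ReachesAvoiding G e u v) (hvw : ReachesAvoiding G e v w) :
    ReachesAvoiding G e u w := by
  obtain ⟨p, hp⟩ := huv
  obtain ⟨q, hq⟩ := hvw
  exact ⟨append p q, by simp [edges_append, hp, hq]⟩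

theorem of_adj (huv : G.Adj u v) (he : e ≠ (u, v)) : ReachesAvoiding G e u v :=
  ⟨.cons huv (.nil v), by simpa [Walk.edges] using he⟩

theorem reverse (h : ReachesAvoiding G e u v) : ReachesAvoiding G.reverse e.swap v u := by
  obtain ⟨p, hp⟩ := h
  obtain ⟨q, hq⟩ := exists_walk_reverse p
  exact ⟨q, by rwa [hq, Prod.swap_swap]⟩

end ReachesAvoiding

theorem reachesAvoiding_reverse :
    ReachesAvoiding G.reverse e u v ↔ ReachesAvoiding G e.swap v u :=
  ⟨ReachesAvoiding.reverse, fun h => by simpa using h.reverse⟩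

theorem reachesAvoiding_or_reachesAvoiding_snd (h : G.Reaches u v) (e : V × V) :
    ReachesAvoiding G e u v ∨ ReachesAvoiding G e e.2 v := by
  obtain ⟨p⟩ := h
  by_cases he : e ∈ p.edges
  · obtain ⟨_, rfl, q, -, hq⟩ := exists_walk_from_last_visit p (S := {e.2})
      ⟨e.2, List.mem_of_mem_tail (snd_mem_support_tail_of_mem_edges p he), rfl⟩
    exact .inr ⟨q, fun h => hq _ (snd_mem_support_tail_of_mem_edges q h) rfl⟩
  · exact .inl ⟨p, he⟩

/-! ### Menger's theorem for two edge-disjoint walks -/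

theorem ReachesAvoiding.exists_walk_between (h : ReachesAvoiding G e x y) {S T : Set V}
    (hx : x ∈ S) (hy : y ∈ T) :
    ∃ a ∈ S, ∃ b ∈ T, ∃ p : G.Walk a b, e ∉ p.edges ∧ ∀ f ∈ p.edges, f.1 ∉ T ∧ f.2 ∉ S := by
  obtain ⟨p, hp⟩ := h
  obtain ⟨a, ha, q, hqp, hq⟩ := exists_walk_from_last_visit p ⟨x, start_mem_support p, hx⟩
  obtain ⟨b, hb, q', hq'q, hq'⟩ := exists_walk_to_first_visit q hy
  exact ⟨a, ha, b, hb, q', fun he => hp (hqp (hq'q he)), fun f hf =>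
    ⟨hq' f hf, hq _ (snd_mem_support_tail_of_mem_edges q (hq'q hf))⟩⟩

/- Write `t` as an edge `(w, b)` followed by `t'`. A walk avoiding `(w, b)` contains a detour from
`p` or `q`, say from `p`, to a vertex `d` of `t'` that is edge-disjoint from everything so far.
Following `p` and then the detour, or `q` and then `t`, one reaches `d`, closer to `y` than `w`. -/
theorem twoEdgeDisjointPaths_of_disjoint_walks (h : ∀ e, ReachesAvoiding G e x y)
    (p q : G.Walk x w) (t : G.Walk w y) (ht : t.edges.Nodup) (hpq : p.edges.Disjoint q.edges)
    (hpt : p.edges.Disjoint t.edges) (hqt : q.edges.Disjoint t.edges) :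
    G.TwoEdgeDisjointPaths x y := by
  induction hn : t.edges.length using Nat.strong_induction_on generalizing w with
  | _ n ih =>
    cases t with
    | nil => exact ⟨p, q, hpq⟩
    | @cons _ b _ hwb t' =>
      obtain ⟨c, hc, d, hd, detour, hwb_detour, hdetour⟩ :=
        (h (w, b)).exists_walk_between (S := {z | z ∈ p.support ∨ z ∈ q.support})
          (T := {z | z ∈ t'.support}) (.inl (start_mem_support p)) (end_mem_support t')
      wlog hcp : c ∈ p.support generalizing p q
      · exact this q p hpq.symm hqt hpt hc.symm (fun f hf => by simpa [or_comm] using hdetour f hf)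
          (hc.resolve_left hcp)
      obtain ⟨p₁, p₂, rfl⟩ := exists_eq_append_of_mem_support p hcp
      obtain ⟨t₁, t₂, rfl⟩ := exists_eq_append_of_mem_support t' hd
      have hdetour_q : detour.edges.Disjoint q.edges := fun f hf hfq => (hdetour f hf).2
        (.inr (List.mem_of_mem_tail (snd_mem_support_tail_of_mem_edges q hfq)))
      have hdetour_t : detour.edges.Disjoint (append t₁ t₂).edges := fun f hf hft =>
        (hdetour f hf).1 (fst_mem_support_of_mem_edges _ hft)
      simp only [Walk.edges, edges_append] at ht hpq hpt hqt hdetour_t hn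
      refine ih t₂.edges.length ?_ (append p₁ detour) (append q (.cons hwb t₁)) t₂ ?_ ?_ ?_ ?_ rfl
      · grind
      · grind
      all_goals simp only [Walk.edges, edges_append]
      all_goals grind [List.Disjoint]

theorem twoEdgeDisjointPaths_iff :
    G.TwoEdgeDisjointPaths x y ↔ ∀ e, ReachesAvoiding G e x y := by
  constructor
  · rintro ⟨p, q, hpq⟩ e
    by_cases he : e ∈ p.edges
    · exact ⟨q, hpq he⟩
    · exact ⟨p, he⟩
  · intro h
    obtain ⟨p, -⟩ := h (x, x)
    obtain ⟨t, ht⟩ := exists_walk_edges_nodup p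
    exact twoEdgeDisjointPaths_of_disjoint_walks h (.nil x) (.nil x) t ht
      (List.disjoint_nil_left _) (List.disjoint_nil_left _) (List.disjoint_nil_left _)

/-! ### Dominators and bridges -/

theorem dominates_refl (v : V) : G.Dominates s v v := fun p => end_mem_support p

theorem dominates_start (v : V) : G.Dominates s s v := fun p => start_mem_support p

theorem dominates_of_not_mem_support_tail (h : G.Dominates s a w) (q : G.Walk v w)
    (hq : a ∉ q.support.tail) : G.Dominates s a v := fun p =>
  (List.mem_append.1 (support_append p q ▸ h (append p q))).resolve_right hq

theorem dominates_total (hv : G.Reaches s v) (ha : G.Dominates s a v) (hb : G.Dominates s b v) :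
    G.Dominates s a b ∨ G.Dominates s b a := by
  obtain ⟨p⟩ := hv
  obtain ⟨_, rfl | rfl, q, -, hq⟩ := exists_walk_from_last_visit p (S := {a, b}) ⟨a, ha p, .inl rfl⟩
  · exact .inr (dominates_of_not_mem_support_tail hb q fun h => hq _ h (.inr rfl))
  · exact .inl (dominates_of_not_mem_support_tail ha q fun h => hq _ h (.inl rfl))

theorem exists_domTree_adj (hv : G.Reaches s v) (hvs : v ≠ s) : ∃ a, (G.domTree s).Adj a v := by
  obtain ⟨p⟩ := hv
  obtain ⟨a, ⟨hav, ha⟩, q, -, hq⟩ := exists_walk_from_last_visit p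
    (S := {w | w ≠ v ∧ G.Dominates s w v}) ⟨s, start_mem_support p, hvs.symm, dominates_start v⟩
  exact ⟨a, hav, ha, fun w hwv hw =>
    dominates_of_not_mem_support_tail hw q fun h => hq w h ⟨hwv, hw⟩⟩

theorem domTree_adj_unique (hs : ∀ v, G.Reaches s v) (ha : (G.domTree s).Adj a v)
    (hb : (G.domTree s).Adj b v) : a = b :=
  (hb.2.2 a ha.1 ha.2.1).antisymm (hs a) (ha.2.2 b hb.1 hb.2.1)

theorem not_dominates_of_domTree_adj (hs : ∀ v, G.Reaches s v) (h : (G.domTree s).Adj u v) :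
    ¬ G.Dominates s v u := fun hvu => h.1 (h.2.1.antisymm (hs u) hvu)

theorem not_domTree_adj_start : ¬ (G.domTree s).Adj a s := fun h =>
  h.1 (List.mem_singleton.1 (h.2.1 (.nil s)))

theorem domTree_induction (hs : ∀ v, G.Reaches s v) {P : V → Prop} (start : P s)
    (step : ∀ a b, (G.domTree s).Adj a b → P a → P b) (v : V) : P v := by
  obtain ⟨p⟩ := hs v
  induction hn : p.support.length using Nat.strong_induction_on generalizing v with
  | _ n ih =>
    rcases eq_or_ne v s with rfl | hv
    · exact start
    · obtain ⟨a, ha⟩ := exists_domTree_adj ⟨p⟩ hv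
      obtain ⟨q, -, -, hqp⟩ := p.exists_prefix (ha.2.1 p)
      exact step a v ha (ih _ (hn ▸ hqp ha.1) a q rfl)

theorem isBridge_of_not_reachesAvoiding (hs : ∀ v, G.Reaches s v)
    (h : ¬ ReachesAvoiding G e s x) : G.IsBridge s e.1 e.2 := by
  have he : ∀ p : G.Walk s e.2, e ∈ p.edges := fun p => by_contra fun hp =>
    h ((reachesAvoiding_or_reachesAvoiding_snd (hs x) e).elim id (.trans ⟨p, hp⟩))
  obtain ⟨p⟩ := hs e.2
  exact ⟨adj_of_mem_edges p (he p), he⟩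

theorem dominates_iff_not_reachesAvoiding (h : G.IsBridge s u v) :
    G.Dominates s v x ↔ ¬ ReachesAvoiding G (u, v) s x := by
  constructor
  · rintro hvx ⟨p, hp⟩
    obtain ⟨q, q', rfl⟩ := exists_eq_append_of_mem_support p (hvx p)
    exact hp (edges_append q q' ▸ List.mem_append_left _ (h.2 q))
  · intro hx p
    by_contra hvp
    exact hx ⟨p, fun he => hvp (List.mem_of_mem_tail (snd_mem_support_tail_of_mem_edges p he))⟩

theorem isBridge_ne (hs : ∀ v, G.Reaches s v) (h : G.IsBridge s u v) : u ≠ v := by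
  rintro rfl
  obtain ⟨p⟩ := hs u
  obtain ⟨_, rfl, q, -, hq⟩ := exists_walk_to_first_visit p (Set.mem_singleton u)
  exact hq _ (h.2 q) rfl

theorem domTree_adj_of_isBridge (hs : ∀ v, G.Reaches s v) (h : G.IsBridge s u v) :
    (G.domTree s).Adj u v :=
  ⟨isBridge_ne hs h, fun p => fst_mem_support_of_mem_edges p (h.2 p), fun _ hwv hw =>
    dominates_of_not_mem_support_tail hw (.cons h.1 (.nil v)) (by simpa [Walk.support] using hwv)⟩

theorem eq_of_adj_of_isBridge (h : G.IsBridge s u v) (hxy : G.Adj x y)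
    (hx : ¬ G.Dominates s v x) (hy : G.Dominates s v y) : x = u ∧ y = v := by
  rw [dominates_iff_not_reachesAvoiding h] at hx hy
  by_contra hne
  exact hy ((not_not.1 hx).trans (.of_adj hxy fun he => hne (Prod.mk.inj he.symm)))

/-! ### Walks below a vertex of the dominator tree -/

/-- `y` is reachable from `x` in the subgraph induced by the descendants of `r` in the dominator
tree. This is the reachability relation that the contraction defining the auxiliary graph of `r`
preserves. -/
def ReachesBelow (G : Digraph V) (s r x y : V) : Prop :=
  ∃ p : G.Walk x y, ∀ w ∈ p.support, G.Dominates s r w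

namespace ReachesBelow

theorem refl (h : G.Dominates s r x) : ReachesBelow G s r x x :=
  ⟨.nil x, by simpa [Walk.support] using h⟩

theorem trans (hxy : ReachesBelow G s r x y) (hyz : ReachesBelow G s r y z) :
    ReachesBelow G s r x z := by
  obtain ⟨p, hp⟩ := hxy
  obtain ⟨q, hq⟩ := hyz
  refine ⟨append p q, fun w hw => ?_⟩
  rw [support_append, List.mem_append] at hw
  exact hw.elim (hp w) fun hw => hq w (List.mem_of_mem_tail hw)

theorem of_adj (hxy : G.Adj x y) (hx : G.Dominates s r x) (hy : G.Dominates s r y) :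
    ReachesBelow G s r x y :=
  ⟨.cons hxy (.nil y), by simpa [Walk.support] using ⟨hx, hy⟩⟩

theorem mono (hra : G.Dominates s r a) (h : ReachesBelow G s a x y) : ReachesBelow G s r x y :=
  h.imp fun _ hp w hw => hra.trans (hp w hw)

theorem of_dominates (hx : G.Reaches s x) (h : G.Dominates s a x) : ReachesBelow G s a a x := by
  obtain ⟨p⟩ := hx
  obtain ⟨_, rfl, q, -, hq⟩ := exists_walk_from_last_visit p (S := {a}) ⟨a, h p, rfl⟩
  refine ⟨q, fun w hw => ?_⟩
  obtain ⟨q₁, q₂, rfl⟩ := exists_eq_append_of_mem_support q hw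
  refine dominates_of_not_mem_support_tail h q₂ fun haq => hq _ ?_ rfl
  rw [support_append, support_eq_cons_tail q₁]
  exact List.mem_append_right _ haq

theorem reachesAvoiding (hs : ∀ v, G.Reaches s v) (hxy : ReachesBelow G s r x y)
    (hr : ¬ ReachesAvoiding G e s r) : ReachesAvoiding G e x y := by
  obtain ⟨p, hp⟩ := hxy
  have he := isBridge_of_not_reachesAvoiding hs hr
  refine ⟨p, fun hep => not_dominates_of_domTree_adj hs (domTree_adj_of_isBridge hs he) ?_⟩
  exact ((dominates_iff_not_reachesAvoiding he).2 hr).trans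
    (hp _ (fst_mem_support_of_mem_edges p hep))

theorem of_isBridge (h : G.IsBridge s u r) (hy : G.Dominates s r y)
    (hxy : ReachesAvoiding G (u, r) x y) : ReachesBelow G s r x y := by
  obtain ⟨p, hp⟩ := hxy
  refine ⟨p, fun w hw => ?_⟩
  obtain ⟨q, q', rfl⟩ := exists_eq_append_of_mem_support p hw
  rw [dominates_iff_not_reachesAvoiding h] at hy ⊢
  exact fun hsw => hy (hsw.trans
    ⟨q', fun he => hp (edges_append q q' ▸ List.mem_append_right _ he)⟩)

end ReachesBelow

/-! ### Roots of the bridge decomposition -/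

theorem isBridgeRoot_self_of_isBridge (hs : ∀ v, G.Reaches s v) (h : G.IsBridge s u v) :
    G.IsBridgeRoot s v v := by
  refine ⟨⟨.nil v⟩, fun w hw => hw.2 ?_⟩
  rwa [domTree_adj_unique hs hw.1 (domTree_adj_of_isBridge hs h)]

theorem exists_isBridgeRoot (hs : ∀ v, G.Reaches s v) (x : V) : ∃ r, G.IsBridgeRoot s r x := by
  induction x using domTree_induction hs with
  | start => exact ⟨s, ⟨.nil s⟩, fun _ h => not_domTree_adj_start h.1⟩
  | step a b hab ih =>
    by_cases hb : G.IsBridge s a b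
    · exact ⟨b, isBridgeRoot_self_of_isBridge hs hb⟩
    · obtain ⟨r, hra, hr⟩ := ih
      exact ⟨r, hra.concat ⟨hab, hb⟩, hr⟩

theorem isBridgeRoot_self (h : G.IsBridgeRoot s r x) : G.IsBridgeRoot s r r := ⟨⟨.nil r⟩, h.2⟩

theorem isBridgeRoot_dominates (h : G.IsBridgeRoot s r x) : G.Dominates s r x := by
  obtain ⟨⟨p⟩, -⟩ := h
  induction p with
  | nil a => exact dominates_refl a
  | cons hab _ ih => exact hab.1.2.1.trans ih

theorem isBridgeRoot_eq_start_or_isBridge (hs : ∀ v, G.Reaches s v) (h : G.IsBridgeRoot s r x) :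
    r = s ∨ ∃ u, G.IsBridge s u r := by
  refine or_iff_not_imp_left.2 fun hr => ?_
  obtain ⟨a, ha⟩ := exists_domTree_adj (hs r) hr
  exact ⟨a, by_contra fun hb => h.2 a ⟨ha, hb⟩⟩

theorem isBridge_dominates_isBridgeRoot (hs : ∀ v, G.Reaches s v) (hr : G.IsBridgeRoot s r x)
    (h : G.IsBridge s u v) (hvx : G.Dominates s v x) : G.Dominates s v r := by
  obtain ⟨⟨p⟩, -⟩ := hr
  induction p with
  | nil a => exact hvx
  | @cons a b c hab p ih =>
    refine hab.1.2.2 v ?_ (ih hvx)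
    rintro rfl
    obtain rfl := domTree_adj_unique hs hab.1 (domTree_adj_of_isBridge hs h)
    exact hab.2 h

theorem reachesAvoiding_isBridgeRoot_iff (hs : ∀ v, G.Reaches s v) (h : G.IsBridgeRoot s r x) :
    ReachesAvoiding G e s r ↔ ReachesAvoiding G e s x := by
  by_cases he : G.IsBridge s e.1 e.2
  · rw [← not_iff_not]
    change ¬ ReachesAvoiding G (e.1, e.2) s r ↔ ¬ ReachesAvoiding G (e.1, e.2) s x
    rw [← dominates_iff_not_reachesAvoiding he, ← dominates_iff_not_reachesAvoiding he]
    exact ⟨fun her => her.trans (isBridgeRoot_dominates h), isBridge_dominates_isBridgeRoot hs h he⟩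
  · exact iff_of_true (by_contra fun hr => he (isBridge_of_not_reachesAvoiding hs hr))
      (by_contra fun hx => he (isBridge_of_not_reachesAvoiding hs hx))

theorem isBridgeRoot_dominates_isBridgeRoot (hs : ∀ v, G.Reaches s v) (ha : G.IsBridgeRoot s a x)
    (hb : G.IsBridgeRoot s b y) (h : ∀ e, ReachesAvoiding G e s y → ReachesAvoiding G e s x) :
    G.Dominates s a b := by
  rcases isBridgeRoot_eq_start_or_isBridge hs ha with rfl | ⟨u, hu⟩
  · exact dominates_start b
  · refine (dominates_iff_not_reachesAvoiding hu).2 fun hsb => ?_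
    exact (dominates_iff_not_reachesAvoiding hu).1 (dominates_refl a)
      ((reachesAvoiding_isBridgeRoot_iff hs ha).2
        (h _ ((reachesAvoiding_isBridgeRoot_iff hs hb).1 hsb)))

theorem isBridgeRoot_eq_of_forall_reachesAvoiding_iff (hs : ∀ v, G.Reaches s v)
    (ha : G.IsBridgeRoot s a x) (hb : G.IsBridgeRoot s b y)
    (h : ∀ e, ReachesAvoiding G e s x ↔ ReachesAvoiding G e s y) : a = b :=
  (isBridgeRoot_dominates_isBridgeRoot hs ha hb fun e => (h e).2).antisymm (hs a)
    (isBridgeRoot_dominates_isBridgeRoot hs hb ha fun e => (h e).1)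

theorem isBridgeRoot_unique (hs : ∀ v, G.Reaches s v) (ha : G.IsBridgeRoot s a x)
    (hb : G.IsBridgeRoot s b x) : a = b :=
  isBridgeRoot_eq_of_forall_reachesAvoiding_iff hs ha hb fun _ => Iff.rfl

theorem bridgeRoot_eq_iff (hs : ∀ v, G.Reaches s v) :
    G.bridgeRoot s x = r ↔ G.IsBridgeRoot s r x := by
  have hx : G.IsBridgeRoot s (G.bridgeRoot s x) x := by
    rw [bridgeRoot, dif_pos (exists_isBridgeRoot hs x)]
    exact (exists_isBridgeRoot hs x).choose_spec
  exact ⟨fun h => h ▸ hx, isBridgeRoot_unique hs hx⟩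

theorem reachesBelow_iff_forall_reachesAvoiding (hs : ∀ v, G.Reaches s v)
    (hy : G.IsBridgeRoot s r y) (hxy : G.Reaches x y) :
    ReachesBelow G s r x y ↔ ∀ e, ¬ ReachesAvoiding G e s r → ReachesAvoiding G e x y := by
  refine ⟨fun h e => h.reachesAvoiding hs, fun h => ?_⟩
  rcases isBridgeRoot_eq_start_or_isBridge hs hy with rfl | ⟨u, hu⟩
  · obtain ⟨p⟩ := hxy
    exact ⟨p, fun w _ => dominates_start w⟩
  · exact .of_isBridge hu (isBridgeRoot_dominates hy)
      (h _ ((dominates_iff_not_reachesAvoiding hu).1 (dominates_refl r)))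

/-! ### Auxiliary graphs -/

theorem isBridge_of_domTree_adj_of_notMem (hs : ∀ v, G.Reaches s v) (ha : a ∈ G.auxVertices s r)
    (haw : (G.domTree s).Adj a w) (hw : w ∉ G.auxVertices s r) : G.IsBridge s a w := by
  by_contra h
  have har := (bridgeRoot_eq_iff hs).1 ha
  exact hw ((bridgeRoot_eq_iff hs).2 ⟨har.1.concat ⟨haw, h⟩, har.2⟩)

theorem not_dominates_of_mem_auxVertices (hs : ∀ v, G.Reaches s v) (ha : a ∈ G.auxVertices s r)
    (haw : (G.domTree s).Adj a w) (hw : w ∉ G.auxVertices s r) (hc : c ∈ G.auxVertices s r) :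
    ¬ G.Dominates s w c := by
  intro hwc
  have hwr : G.Dominates s w r := isBridge_dominates_isBridgeRoot hs ((bridgeRoot_eq_iff hs).1 hc)
    (isBridge_of_domTree_adj_of_notMem hs ha haw hw) hwc
  have hra : G.Dominates s r a := isBridgeRoot_dominates ((bridgeRoot_eq_iff hs).1 ha)
  exact not_dominates_of_domTree_adj hs haw (hwr.trans hra)

theorem contractsTo_self (ha : a ∈ G.auxVertices s r) : G.ContractsTo s r a a := ⟨ha, .inl rfl⟩

theorem contractsTo_dominates (h : G.ContractsTo s r x a) : G.Dominates s a x := by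
  rcases h.2 with rfl | ⟨w, haw, -, hwx⟩
  · exact dominates_refl x
  · exact haw.2.1.trans hwx

theorem dominates_of_contractsTo (hs : ∀ v, G.Reaches s v) (h : G.ContractsTo s r x a)
    (hc : c ∈ G.auxVertices s r) (hcx : G.Dominates s c x) : G.Dominates s c a := by
  obtain ⟨ha, rfl | ⟨w, haw, hw, hwx⟩⟩ := h
  · exact hcx
  · have hcw : G.Dominates s c w := (dominates_total (hs x) hcx hwx).resolve_right
      (not_dominates_of_mem_auxVertices hs ha haw hw hc)
    exact haw.2.2 c (ne_of_mem_of_not_mem hc hw) hcw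

theorem contractsTo_unique (hs : ∀ v, G.Reaches s v) (ha : G.ContractsTo s r x a)
    (hb : G.ContractsTo s r x b) : a = b :=
  (dominates_of_contractsTo hs hb ha.1 (contractsTo_dominates ha)).antisymm (hs a)
    (dominates_of_contractsTo hs ha hb.1 (contractsTo_dominates hb))

theorem exists_contractsTo (hs : ∀ v, G.Reaches s v) (hr : r ∈ G.auxVertices s r)
    (hrx : G.Dominates s r x) : ∃ a, G.ContractsTo s r x a := by
  induction x using domTree_induction hs with
  | start =>
    obtain rfl := hrx.antisymm (hs r) (dominates_start r)
    exact ⟨r, contractsTo_self hr⟩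
  | step b x hbx ih =>
    rcases eq_or_ne r x with rfl | hne
    · exact ⟨r, contractsTo_self hr⟩
    obtain ⟨a, ha, rfl | ⟨w, haw, hw, hwb⟩⟩ := ih (hbx.2.2 r hne hrx)
    · by_cases hx : x ∈ G.auxVertices s r
      · exact ⟨x, contractsTo_self hx⟩
      · exact ⟨b, ha, .inr ⟨x, hbx, hx, dominates_refl x⟩⟩
    · exact ⟨a, ha, .inr ⟨w, haw, hw, hwb.trans hbx.2.1⟩⟩

theorem reachesBelow_of_auxGraph_adj (hs : ∀ v, G.Reaches s v) {a b : G.auxVertices s r}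
    (h : (G.auxGraph s r).Adj a b) : ReachesBelow G s r a b := by
  obtain ⟨x, y, hxy, hxa, hyb⟩ := h
  have hra := isBridgeRoot_dominates ((bridgeRoot_eq_iff hs).1 a.2)
  have hrb := isBridgeRoot_dominates ((bridgeRoot_eq_iff hs).1 b.2)
  have hax := contractsTo_dominates hxa
  obtain ⟨hb, rfl | ⟨w, hbw, hw, hwy⟩⟩ := hyb
  · exact ((ReachesBelow.of_dominates (hs x) hax).mono hra).trans (.of_adj hxy (hra.trans hax) hrb)
  · have hxb : G.ContractsTo s r x b := by
      by_cases hwx : G.Dominates s w x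
      · exact ⟨hb, .inr ⟨w, hbw, hw, hwx⟩⟩
      · have hbridge := isBridge_of_domTree_adj_of_notMem hs hb hbw hw
        exact ⟨hb, .inl (eq_of_adj_of_isBridge hbridge hxy hwx hwy).1⟩
    exact contractsTo_unique hs hxa hxb ▸ ReachesBelow.refl hra

theorem auxGraph_reaches_of_contractsTo (hs : ∀ v, G.Reaches s v) {a b : G.auxVertices s r}
    (p : G.Walk x y) (hp : ∀ w ∈ p.support, G.Dominates s r w) (hx : G.ContractsTo s r x a)
    (hy : G.ContractsTo s r y b) : (G.auxGraph s r).Reaches a b := by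
  have hr : r ∈ G.auxVertices s r :=
    (bridgeRoot_eq_iff hs).2 (isBridgeRoot_self ((bridgeRoot_eq_iff hs).1 b.2))
  induction p generalizing a with
  | nil x =>
    obtain rfl : a = b := Subtype.ext (contractsTo_unique hs hx hy)
    exact ⟨.nil a⟩
  | @cons x z y hxz p ih =>
    obtain ⟨c, hc⟩ := exists_contractsTo hs hr
      (hp z (List.mem_cons_of_mem _ (start_mem_support p)))
    obtain ⟨q⟩ := ih (a := ⟨c, hc.1⟩) (fun w hw => hp w (List.mem_cons_of_mem _ hw)) hc hy
    exact ⟨.cons ⟨x, z, hxz, hx, hc⟩ q⟩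

theorem auxGraph_reaches_iff (hs : ∀ v, G.Reaches s v) {a b : G.auxVertices s r} :
    (G.auxGraph s r).Reaches a b ↔ ReachesBelow G s r a b := by
  constructor
  · rintro ⟨p⟩
    induction p with
    | nil a => exact .refl (isBridgeRoot_dominates ((bridgeRoot_eq_iff hs).1 a.2))
    | cons hab _ ih => exact (reachesBelow_of_auxGraph_adj hs hab).trans ih
  · rintro ⟨p, hp⟩
    exact auxGraph_reaches_of_contractsTo hs p hp (contractsTo_self a.2) (contractsTo_self b.2)

/-! ### Auxiliary components -/

theorem mem_auxComponent_iff (hs : ∀ v, G.Reaches s v) :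
    y ∈ G.auxComponent s x ↔ ∃ r, G.IsBridgeRoot s r x ∧ G.IsBridgeRoot s r y ∧
      ReachesBelow G s r x y ∧ ReachesBelow G s r y x := by
  constructor
  · rintro ⟨b, ⟨hxb, hbx⟩, rfl⟩
    exact ⟨_, (bridgeRoot_eq_iff hs).1 rfl, (bridgeRoot_eq_iff hs).1 b.2,
      (auxGraph_reaches_iff hs).1 hxb, (auxGraph_reaches_iff hs).1 hbx⟩
  · rintro ⟨r, hx, hy, hxy, hyx⟩
    obtain rfl := (bridgeRoot_eq_iff hs).2 hx
    exact ⟨⟨y, (bridgeRoot_eq_iff hs).2 hy⟩,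
      ⟨(auxGraph_reaches_iff hs).2 hxy, (auxGraph_reaches_iff hs).2 hyx⟩, rfl⟩

theorem mem_auxComponent_comm (hs : ∀ v, G.Reaches s v) :
    y ∈ G.auxComponent s x ↔ x ∈ G.auxComponent s y := by
  simp only [mem_auxComponent_iff hs]
  grind

theorem mem_auxComponent_trans (hs : ∀ v, G.Reaches s v) (hy : y ∈ G.auxComponent s x)
    (hz : z ∈ G.auxComponent s y) : z ∈ G.auxComponent s x := by
  rw [mem_auxComponent_iff hs] at *
  obtain ⟨r, hrx, hry, hxy, hyx⟩ := hy
  obtain ⟨r', hry', hrz, hyz, hzy⟩ := hz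
  obtain rfl := isBridgeRoot_unique hs hry hry'
  exact ⟨r, hrx, hrz, hxy.trans hyz, hzy.trans hyx⟩

theorem auxComponent_eq_of_mem (hs : ∀ v, G.Reaches s v) (h : y ∈ G.auxComponent s x) :
    G.auxComponent s x = G.auxComponent s y :=
  Set.ext fun _ => ⟨mem_auxComponent_trans hs ((mem_auxComponent_comm hs).1 h),
    mem_auxComponent_trans hs h⟩

theorem canonical_eq_iff (hs : ∀ v, G.Reaches s v) {can : Set V → V}
    (hcan : G.IsCanonicalChoice s can) :
    can (G.auxComponent s x) = can (G.auxComponent s y) ↔ y ∈ G.auxComponent s x := by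
  refine ⟨fun h => ?_, fun h => congrArg can (auxComponent_eq_of_mem hs h)⟩
  exact mem_auxComponent_trans hs (hcan x) ((mem_auxComponent_comm hs).1 (h ▸ hcan y))

theorem bridgeRoot_eq_of_mem_auxComponent (hs : ∀ v, G.Reaches s v)
    (h : y ∈ G.auxComponent s x) : G.bridgeRoot s x = G.bridgeRoot s y := by
  obtain ⟨r, hx, hy, -⟩ := (mem_auxComponent_iff hs).1 h
  rw [(bridgeRoot_eq_iff hs).2 hx, (bridgeRoot_eq_iff hs).2 hy]

theorem label_eq_iff (hG : G.StronglyConnected) {can canR : Set V → V}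
    (hcan : G.IsCanonicalChoice s can) (hcanR : G.reverse.IsCanonicalChoice s canR) :
    G.label s can canR x = G.label s can canR y ↔
      y ∈ G.auxComponent s x ∧ y ∈ G.reverse.auxComponent s x := by
  have hs := hG s
  have hsR := stronglyConnected_reverse hG s
  simp only [label, Prod.mk.injEq, canonical_eq_iff hs hcan, canonical_eq_iff hsR hcanR]
  exact ⟨fun h => ⟨h.2.1, h.2.2.2⟩, fun h => ⟨bridgeRoot_eq_of_mem_auxComponent hs h.1, h.1,
    bridgeRoot_eq_of_mem_auxComponent hsR h.2, h.2⟩⟩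

theorem mem_auxComponent_iff_forall_reachesAvoiding (hG : G.StronglyConnected) :
    y ∈ G.auxComponent s x ↔ ∀ e, (ReachesAvoiding G e s x ∧ ReachesAvoiding G e s y) ∨
      (ReachesAvoiding G e x y ∧ ReachesAvoiding G e y x) := by
  have hs := hG s
  rw [mem_auxComponent_iff hs]
  constructor
  · rintro ⟨r, hx, hy, hxy, hyx⟩ e
    rw [← reachesAvoiding_isBridgeRoot_iff hs hx, ← reachesAvoiding_isBridgeRoot_iff hs hy]
    by_cases hr : ReachesAvoiding G e s r
    · exact .inl ⟨hr, hr⟩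
    · exact .inr ⟨(reachesBelow_iff_forall_reachesAvoiding hs hy (hG x y)).1 hxy e hr,
        (reachesBelow_iff_forall_reachesAvoiding hs hx (hG y x)).1 hyx e hr⟩
  · intro h
    obtain ⟨r, hx⟩ := exists_isBridgeRoot hs x
    obtain ⟨r', hy⟩ := exists_isBridgeRoot hs y
    obtain rfl : r = r' := isBridgeRoot_eq_of_forall_reachesAvoiding_iff hs hx hy fun e =>
      (h e).elim (fun hsxy => iff_of_true hsxy.1 hsxy.2)
        fun hxy => ⟨fun hsx => hsx.trans hxy.1, fun hsy => hsy.trans hxy.2⟩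
    have hxy : ∀ e, ¬ ReachesAvoiding G e s r →
        ReachesAvoiding G e x y ∧ ReachesAvoiding G e y x := fun e hr =>
      (h e).resolve_left fun hsxy => hr ((reachesAvoiding_isBridgeRoot_iff hs hx).2 hsxy.1)
    exact ⟨r, hx, hy,
      (reachesBelow_iff_forall_reachesAvoiding hs hy (hG x y)).2 fun e hr => (hxy e hr).1,
      (reachesBelow_iff_forall_reachesAvoiding hs hx (hG y x)).2 fun e hr => (hxy e hr).2⟩

theorem mem_auxComponent_reverse_iff_forall_reachesAvoiding (hG : G.StronglyConnected) :
    y ∈ G.reverse.auxComponent s x ↔ ∀ e, (ReachesAvoiding G e x s ∧ ReachesAvoiding G e y s) ∨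
      (ReachesAvoiding G e y x ∧ ReachesAvoiding G e x y) := by
  simp only [mem_auxComponent_iff_forall_reachesAvoiding (stronglyConnected_reverse hG),
    reachesAvoiding_reverse]
  exact ⟨fun h e => e.swap_swap ▸ h e.swap, fun h e => h e.swap⟩

theorem twoEdgeConnected_iff : G.TwoEdgeConnected x y ↔
    ∀ e, ReachesAvoiding G e x y ∧ ReachesAvoiding G e y x := by
  rw [TwoEdgeConnected, twoEdgeDisjointPaths_iff, twoEdgeDisjointPaths_iff, forall_and]

end FlowGraph

open FlowGraph in
theorem mainTheorem4_general {V : Type*} (G : Digraph V) (hG : G.StronglyConnected) (s : V)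
    (can canR : Set V → V) (hcan : G.IsCanonicalChoice s can)
    (hcanR : G.reverse.IsCanonicalChoice s canR) (x y : V) :
    G.TwoEdgeConnected x y ↔ G.label s can canR x = G.label s can canR y := by
  rw [twoEdgeConnected_iff, label_eq_iff hG hcan hcanR,
    mem_auxComponent_iff_forall_reachesAvoiding hG,
    mem_auxComponent_reverse_iff_forall_reachesAvoiding hG]
  constructor
  · exact fun h => ⟨fun e => .inr (h e), fun e => .inr (h e).symm⟩
  · rintro ⟨h, hR⟩ e
    rcases h e with ⟨hsx, hsy⟩ | hxy
    · rcases hR e with ⟨hxs, hys⟩ | hyx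
      · exact ⟨hxs.trans hsy, hys.trans hsx⟩
      · exact hyx.symm
    · exact hxy

theorem mainTheorem4 {V : Type*} [Finite V] (G : Digraph V) (hG : G.StronglyConnected) (s : V)
    (can canR : Set V → V) (hcan : G.IsCanonicalChoice s can)
    (hcanR : G.reverse.IsCanonicalChoice s canR) (x y : V) :
    G.TwoEdgeConnected x y ↔ G.label s can canR x = G.label s can canR y :=
  mainTheorem4_general G hG s can canR hcan hcanR x y
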